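/- Let $q\ge 2$, $n\ge 1$, $m\ge 0$ be integers, let $M,K\in\mathbb{R}^{n\times n}$ be symmetric positive definite, and suppose that the roots of the polynomial $s\mapsto\det(sM-K)$ are distinct. Let $C_d\in\mathbb{R}^{m\times n}$, and let $d_{ij}\ge 0$ $(i,j=1,\dots,q)$ be real numbers with $d_{ij}=d_{ji}$ and $d_{ii}=0$. Consider the array of $q$ coupled oscillators $$M\ddot x_i+Kx_i+\sum_{j=1}^{q}d_{ij}C_d^{T}C_d(\dot x_i-\dot x_j)=0,\qquad i=1,\dots,q,\qquad x_i(t)\in\mathbb{R}^n,\ t\ge 0.$$ The array is said to synchronize if every solution satisfies $\|x_i(t)-x_j(t)\|\to 0$ as $t\to\infty$ for all $i,j$. Let $\ell_d\in\mathbb{R}^{q\times q}$ be the Laplacian matrix with entries $(\ell_d)_{ii}=\sum_{j}d_{ij}$ and $(\ell_d)_{ij}=-d_{ij}$ for $i\ne j$, and let $\lambda_2(\ell_d)$ be its second smallest eigenvalue, counted with multiplicity. Then the array synchronizes if and only if $\lambda_2(\ell_d)>0$ and the pair $(C_d,M^{-1}K)$ is observable, i.e., for the system $\dot x=M^{-1}Kx$,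 $y=C_dx$, the output $y(t)$, $t\ge 0$, determines the initial state $x(0)$. -/

import Mathlib

open scoped Matrix

/-- The Laplacian matrix `lap (w i j)` of a family of scalar weights. -/
def lap {q : ℕ} (w : Fin q → Fin q → ℝ) : Matrix (Fin q) (Fin q) ℝ :=
  Matrix.of fun i j => if i = j then ∑ k, w i k else -w i j

/-- The real part of `λ_k(X)`, the `k`-th smallest eigenvalue (`1 ≤ k ≤ n`) of the complex matrix
`X` with respect to the real part: the roots of the characteristic polynomial, counted with
multiplicity, are ordered by increasing real part. (The value for `k = 0` or `k > n` is
meaningless.) -/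
noncomputable def reEigenvalue {n : ℕ} (X : Matrix (Fin n) (Fin n) ℂ) (k : ℕ) : ℝ :=
  ((X.charpoly.roots.map Complex.re).sort (· ≤ ·)).getD (k - 1) 0

/-- The polynomial `det (s M - K)` in the indeterminate `s`. -/
noncomputable def pencilPoly {n : ℕ} (M K : Matrix (Fin n) (Fin n) ℝ) : Polynomial ℝ :=
  ((Polynomial.X : Polynomial ℝ) • M.map Polynomial.C - K.map Polynomial.C).det

/-- `x` is a trajectory of the linear system `x' = A x` on `[0, ∞)`. -/
def IsLinearTrajectory {n : ℕ} (A : Matrix (Fin n) (Fin n) ℝ) (x : ℝ → Fin n → ℝ) : Prop :=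
  ∀ t : ℝ, 0 ≤ t → HasDerivWithinAt x (A *ᵥ x t) (Set.Ici 0) t

/-- Observability of the pair `(C, A)`: for the system `x' = A x`, `y = C x`, the output on
`[0, ∞)` determines the initial state. -/
def IsObservable {m n : ℕ} (C : Matrix (Fin m) (Fin n) ℝ) (A : Matrix (Fin n) (Fin n) ℝ) : Prop :=
  ∀ x₁ x₂ : ℝ → Fin n → ℝ, IsLinearTrajectory A x₁ → IsLinearTrajectory A x₂ →
    (∀ t : ℝ, 0 ≤ t → C *ᵥ x₁ t = C *ᵥ x₂ t) → x₁ 0 = x₂ 0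

/-- `x` (with `x t i` the position of the `i`-th oscillator at time `t`) solves, on `[0, ∞)`,
the purely dissipatively coupled array
`M xᵢ'' + K xᵢ + ∑ⱼ Dᵢⱼ (xᵢ' - xⱼ') = 0`, `i = 1, …, q`. -/
def IsArraySolution {q n : ℕ} (M K : Matrix (Fin n) (Fin n) ℝ)
    (D : Fin q → Fin q → Matrix (Fin n) (Fin n) ℝ) (x : ℝ → Fin q → Fin n → ℝ) : Prop :=
  ∃ v a : ℝ → Fin q → Fin n → ℝ,
    ∀ t : ℝ, 0 ≤ t →
      HasDerivWithinAt x (v t) (Set.Ici 0) t ∧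
      HasDerivWithinAt v (a t) (Set.Ici 0) t ∧
      ∀ i, M *ᵥ a t i + K *ᵥ x t i + ∑ j, D i j *ᵥ (v t i - v t j) = 0

/-- The array synchronizes: `‖xᵢ(t) - xⱼ(t)‖ → 0` (Euclidean norm) as `t → ∞`, for all indices
`i, j` and all solutions, i.e. all initial conditions. -/
def Synchronizes {q n : ℕ} (M K : Matrix (Fin n) (Fin n) ℝ)
    (D : Fin q → Fin q → Matrix (Fin n) (Fin n) ℝ) : Prop :=
  ∀ x : ℝ → Fin q → Fin n → ℝ, IsArraySolution M K D x →
    ∀ i j, Filter.Tendsto (fun t => ‖WithLp.toLp 2 (x t i - x t j)‖) Filter.atTop (nhds 0)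

/-!
Dividing by the mass matrix, the array is a damped oscillator `x'' + G x' + A x = 0`, where `A` is
symmetric and positive definite and `G` symmetric and positive semidefinite for the inner product
given by the masses. Its energy is a Lyapunov function, and by LaSalle's principle every solution
approaches states along which `G x' = 0`; the span of the positions of such states is generated by
undamped modes, i.e. eigenvectors of `A` in the kernel of `G`. Conversely an undamped mode `u` with
eigenvalue `μ` gives the periodic solution `cos (√μ t) u`. Hence the array synchronizes if and only
if in every undamped mode all oscillators agree.

For the coupling `d i j • Cᵀ * C`, a mode is a family of solutions `u i` of `K u = μ M u` such that
each component of `i ↦ C u i` lies in the kernel of the Laplacian. If that kernel consists of the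
constant families, i.e. if `λ₂ > 0`, then the differences `u i - u j` are eigenvectors in `ker C`,
and these vanish under observability by the Hautus test. Conversely, for an eigenvector `u` the
family `z i • u` is a mode as soon as `z` lies in the kernel of the Laplacian or `C u = 0`.
-/

section SecondEigenvalue

lemma zero_lt_sort_getD_one_iff {α : Type*} [LinearOrder α] [Zero α] {s : Multiset α}
    (hs : ∀ x ∈ s, 0 ≤ x) (hcard : 2 ≤ s.card) :
    0 < (s.sort (· ≤ ·)).getD 1 0 ↔ s.count 0 ≤ 1 := by
  have hsorted := s.pairwise_sort (· ≤ ·)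
  have hcoe := s.sort_eq (· ≤ ·)
  generalize s.sort (· ≤ ·) = l at hsorted hcoe
  subst hcoe
  match l with
  | [] => simp at hcard
  | [a] => simp at hcard
  | a :: b :: t =>
    simp only [List.pairwise_cons, List.mem_cons, forall_eq_or_imp] at hsorted
    simp only [Multiset.mem_coe, List.mem_cons, forall_eq_or_imp] at hs
    simp only [List.getD_cons_succ, List.getD_cons_zero, Multiset.coe_count]
    refine ⟨fun hb => ?_, fun hcount => hs.2.1.lt_of_ne ?_⟩
    · have htail : List.count 0 (b :: t) = 0 :=
        List.count_eq_zero.2 fun hmem => (List.mem_cons.1 hmem).elim hb.ne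
          fun h => (hsorted.2.1 0 h).not_gt hb
      rw [List.count_cons, htail]
      split_ifs <;> simp
    · rintro rfl
      obtain rfl : a = 0 := le_antisymm hsorted.1.1 hs.1
      simp at hcount

variable {ι : Type*} [Fintype ι] [DecidableEq ι] {L : Matrix ι ι ℝ}

lemma roots_charpoly_map_ofReal_map_re (hL : L.IsHermitian) :
    (L.map Complex.ofReal).charpoly.roots.map Complex.re = L.charpoly.roots := by
  have hcharpoly : (L.map Complex.ofReal).charpoly = L.charpoly.map (algebraMap ℝ ℂ) :=
    Matrix.charpoly_map L (algebraMap ℝ ℂ)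
  rw [hcharpoly, hL.splits_charpoly.roots_map, Multiset.map_map]
  exact (Multiset.map_congr rfl fun a _ => Complex.ofReal_re a).trans (Multiset.map_id _)

lemma count_zero_roots_charpoly (hL : L.IsHermitian) :
    L.charpoly.roots.count 0 = Module.finrank ℝ (LinearMap.ker L.mulVecLin) := by
  have hrank : L.rank + Module.finrank ℝ (LinearMap.ker L.mulVecLin) = Fintype.card ι := by
    simpa [Matrix.rank] using LinearMap.finrank_range_add_finrank_ker L.mulVecLin
  have hcount : L.charpoly.roots.count 0 = Fintype.card {i // hL.eigenvalues i = 0} := by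
    rw [hL.roots_charpoly_eq_eigenvalues, Multiset.count_map, Fintype.card_subtype,
      ← Finset.filter_val, Finset.card_val]
    simp [eq_comm]
  rw [hL.rank_eq_card_non_zero_eigs, Fintype.card_subtype_compl] at hrank
  have hle := Fintype.card_subtype_le fun i => hL.eigenvalues i = 0
  omega

end SecondEigenvalue

lemma zero_lt_reEigenvalue_two_iff {n : ℕ} (hn : 2 ≤ n) {L : Matrix (Fin n) (Fin n) ℝ}
    (hL : L.PosSemidef) :
    0 < reEigenvalue (L.map Complex.ofReal) 2 ↔
      Module.finrank ℝ (LinearMap.ker L.mulVecLin) ≤ 1 := by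
  have hroots := hL.isHermitian.roots_charpoly_eq_eigenvalues
  rw [reEigenvalue, roots_charpoly_map_ofReal_map_re hL.isHermitian,
    zero_lt_sort_getD_one_iff, count_zero_roots_charpoly hL.isHermitian]
  · intro x hx
    obtain ⟨i, -, rfl⟩ := Multiset.mem_map.1 (hroots ▸ hx)
    exact hL.eigenvalues_nonneg i
  · simpa [hroots] using hn

section Laplacian

lemma two_nsmul_sum_apply_sum_of_antisymm {ι R E F : Type*} [Fintype ι] [CommRing R]
    [AddCommGroup E] [Module R E] [AddCommGroup F] [Module R F] (B : E →ₗ[R] F →ₗ[R] R)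
    (y : ι → E) {f : ι → ι → F} (hf : ∀ i j, f j i = -f i j) :
    2 • ∑ i, B (y i) (∑ j, f i j) = ∑ i, ∑ j, B (y i - y j) (f i j) := by
  have hswap : ∑ i, ∑ j, B (y i) (f i j) = -∑ i, ∑ j, B (y j) (f i j) := by
    rw [Finset.sum_comm]
    simp only [← Finset.sum_neg_distrib, ← map_neg, ← hf]
  simp only [map_sub, map_sum, LinearMap.sub_apply, Finset.sum_sub_distrib]
  rw [two_nsmul]
  nth_rewrite 2 [hswap]
  exact (sub_eq_add_neg _ _).symm

lemma sum_sum_eq_zero_iff_of_nonneg {ι κ R : Type*} [Fintype ι] [Fintype κ] [AddCommMonoid R]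
    [PartialOrder R] [IsOrderedAddMonoid R] {f : ι → κ → R} (hf : ∀ i j, 0 ≤ f i j) :
    ∑ i, ∑ j, f i j = 0 ↔ ∀ i j, f i j = 0 := by
  rw [Fintype.sum_eq_zero_iff_of_nonneg fun i => Fintype.sum_nonneg (hf i), funext_iff]
  exact forall_congr' fun i => (Fintype.sum_eq_zero_iff_of_nonneg (hf i)).trans funext_iff

variable {q : ℕ} {d : Fin q → Fin q → ℝ}

lemma lap_mulVec_apply (hd_diag : ∀ i, d i i = 0) (z : Fin q → ℝ) (i : Fin q) :
    (lap d *ᵥ z) i = ∑ j, d i j * (z i - z j) := by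
  have hentry (j : Fin q) :
      lap d i j * z j = (if i = j then (∑ k, d i k) * z i else 0) - d i j * z j := by
    rcases eq_or_ne i j with rfl | hij
    · simp [lap, hd_diag]
    · simp [lap, hij]
  simp only [Matrix.mulVec, dotProduct, hentry, Finset.sum_sub_distrib, Finset.sum_ite_eq,
    Finset.mem_univ, if_true, Finset.sum_mul, mul_sub]

lemma lap_isHermitian (hd_symm : ∀ i j, d i j = d j i) : (lap d).IsHermitian := by
  ext i j
  rcases eq_or_ne i j with rfl | hij
  · simp [lap]
  · simp [lap, hij, hij.symm, hd_symm i j]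

lemma two_nsmul_dotProduct_lap_mulVec (hd_symm : ∀ i j, d i j = d j i)
    (hd_diag : ∀ i, d i i = 0) (z : Fin q → ℝ) :
    2 • (z ⬝ᵥ lap d *ᵥ z) = ∑ i, ∑ j, d i j * (z i - z j) ^ 2 := by
  have hparts := two_nsmul_sum_apply_sum_of_antisymm (LinearMap.mul ℝ ℝ) z
    (f := fun i j => d i j * (z i - z j)) fun i j => by rw [hd_symm j i]; ring
  simp only [LinearMap.mul_apply', ← lap_mulVec_apply hd_diag] at hparts
  rw [dotProduct, hparts]
  exact Finset.sum_congr rfl fun i _ => Finset.sum_congr rfl fun j _ => by ring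

lemma lap_posSemidef (hd_nonneg : ∀ i j, 0 ≤ d i j) (hd_symm : ∀ i j, d i j = d j i)
    (hd_diag : ∀ i, d i i = 0) : (lap d).PosSemidef := by
  refine .of_dotProduct_mulVec_nonneg (lap_isHermitian hd_symm) fun z => ?_
  have hsum : 0 ≤ 2 • (z ⬝ᵥ lap d *ᵥ z) := by
    rw [two_nsmul_dotProduct_lap_mulVec hd_symm hd_diag]
    exact Finset.sum_nonneg fun i _ => Finset.sum_nonneg fun j _ =>
      mul_nonneg (hd_nonneg i j) (sq_nonneg _)
  simpa using hsum

lemma lap_mulVec_eq_zero_iff (hd_nonneg : ∀ i j, 0 ≤ d i j) (hd_symm : ∀ i j, d i j = d j i)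
    (hd_diag : ∀ i, d i i = 0) {z : Fin q → ℝ} :
    lap d *ᵥ z = 0 ↔ ∀ i j, d i j * (z i - z j) = 0 := by
  refine ⟨fun hz i j => ?_, fun hz => funext fun i => ?_⟩
  · have hsum := two_nsmul_dotProduct_lap_mulVec hd_symm hd_diag z
    rw [hz, dotProduct_zero, smul_zero, eq_comm] at hsum
    have hij := (sum_sum_eq_zero_iff_of_nonneg fun i j =>
      mul_nonneg (hd_nonneg i j) (sq_nonneg (z i - z j))).1 hsum i j
    simpa using hij
  · rw [lap_mulVec_apply hd_diag]
    exact Finset.sum_eq_zero fun j _ => hz i j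

lemma zero_lt_reEigenvalue_lap_two_iff (hq : 2 ≤ q) (hd_nonneg : ∀ i j, 0 ≤ d i j)
    (hd_symm : ∀ i j, d i j = d j i) (hd_diag : ∀ i, d i i = 0) :
    0 < reEigenvalue ((lap d).map Complex.ofReal) 2 ↔
      ∀ z : Fin q → ℝ, lap d *ᵥ z = 0 → ∀ i j, z i = z j := by
  have hone : (1 : Fin q → ℝ) ∈ LinearMap.ker (lap d).mulVecLin := by
    ext i
    simp [lap_mulVec_apply hd_diag]
  have : NeZero q := ⟨by omega⟩
  rw [zero_lt_reEigenvalue_two_iff hq (lap_posSemidef hd_nonneg hd_symm hd_diag)]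
  refine ⟨fun hker z hz i j => ?_, fun hconst => ?_⟩
  · have hone_ne : (⟨1, hone⟩ : LinearMap.ker (lap d).mulVecLin) ≠ 0 := by simp [Subtype.ext_iff]
    have hfinrank := hker.antisymm (Module.finrank_pos_iff_exists_ne_zero.2 ⟨_, hone_ne⟩)
    obtain ⟨c, hc⟩ := (finrank_eq_one_iff_of_nonzero' _ hone_ne).1 hfinrank ⟨z, hz⟩
    obtain rfl : c • (1 : Fin q → ℝ) = z := congrArg Subtype.val hc
    rfl
  · exact finrank_le_one ⟨1, hone⟩ fun w => ⟨w.1 0, Subtype.ext <| funext fun k => by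
      simpa using hconst w.1 w.2 0 k⟩

end Laplacian

section Eigenspaces

lemma iSup_eigenspace_eq_top_of_isSymm {E : Type*} [AddCommGroup E] [Module ℝ E]
    [FiniteDimensional ℝ E] {m : LinearMap.BilinForm ℝ E} (hm : m.IsSymm)
    (hm_pos : ∀ x, x ≠ 0 → 0 < m x x) {f : Module.End ℝ E}
    (hf : (m ∘ₗ f).IsSymm) : ⨆ μ, f.eigenspace μ = ⊤ := by
  let core : InnerProductSpace.Core ℝ E :=
    { inner := fun x y => m x y
      conj_inner_symm := fun x y => hm.eq y x
      re_inner_nonneg := fun x => by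
        rcases eq_or_ne x 0 with rfl | hx
        · simp
        · exact (hm_pos x hx).le
      add_left := fun x y z => by simp
      smul_left := fun x y r => by simp
      definite := fun x hx => by_contra fun hne => (hm_pos x hne).ne' hx }
  let _ : NormedAddCommGroup E := core.toNormedAddCommGroup
  let _ : InnerProductSpace ℝ E := InnerProductSpace.ofCore core.toCore
  have hf_symm : f.IsSymmetric := fun x y => (hf.eq x y).trans (hm.eq (f y) x)
  exact Submodule.orthogonal_eq_bot_iff.1 hf_symm.orthogonalComplement_iSup_eigenspaces_eq_bot

lemma le_of_forall_eigenvector_mem {k E : Type*} [Field k] [AddCommGroup E] [Module k E]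
    [FiniteDimensional k E] {f : Module.End k E} (hf : ⨆ μ, f.eigenspace μ = ⊤)
    {p N : Submodule k E} (hp : ∀ x ∈ p, f x ∈ p)
    (hN : ∀ (μ : k) u, f u = μ • u → u ∈ p → u ∈ N) : p ≤ N := by
  have hp_eq := p.eq_iSup_inf_genEigenspace 1 hp hf
  rw [hp_eq]
  exact iSup_le fun μ u hu => hN μ u (Module.End.mem_eigenspace_iff.1 hu.2) hu.1

end Eigenspaces

section Trajectories

variable {E F : Type*} [NormedAddCommGroup E] [NormedSpace ℝ E] [NormedAddCommGroup F]
  [NormedSpace ℝ F] {S : E →L[ℝ] E} {w : ℝ → E}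

/-- `w` is a trajectory on `[0, ∞)` of the linear system `w' = S w`; the coordinate-free form of
`IsLinearTrajectory`. -/
def IsTrajectory (S : E →L[ℝ] E) (w : ℝ → E) : Prop :=
  ∀ t : ℝ, 0 ≤ t → HasDerivWithinAt w (S (w t)) (Set.Ici 0) t

lemma isTrajectory_exp [CompleteSpace E] (S : E →L[ℝ] E) (z : E) :
    IsTrajectory S fun t => NormedSpace.exp (t • S) z := fun t _ => by
  simpa using ((hasDerivAt_exp_smul_const' (𝕂 := ℝ) S t).clm_apply
    (hasDerivAt_const t z)).hasDerivWithinAt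

lemma isTrajectory_exp_smul {μ : ℝ} {u : E} (hu : S u = μ • u) :
    IsTrajectory S fun t => Real.exp (μ * t) • u := fun t _ => by
  have hexp : HasDerivAt (fun t : ℝ => Real.exp (μ * t)) (Real.exp (μ * t) * μ) t := by
    simpa using ((hasDerivAt_id t).const_mul μ).exp
  simpa [hu, mul_smul] using (hexp.smul_const u).hasDerivWithinAt (s := Set.Ici 0)

namespace IsTrajectory

lemma sub {w₁ w₂ : ℝ → E} (hw₁ : IsTrajectory S w₁) (hw₂ : IsTrajectory S w₂) :
    IsTrajectory S fun t => w₁ t - w₂ t := fun t ht => by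
  rw [map_sub]
  exact (hw₁ t ht).sub (hw₂ t ht)

lemma continuousOn (hw : IsTrajectory S w) : ContinuousOn w (Set.Ici 0) :=
  fun t ht => (hw t ht).continuousWithinAt

lemma comp_add_const (hw : IsTrajectory S w) {s : ℝ} (hs : 0 ≤ s) :
    IsTrajectory S fun t => w (t + s) := fun t ht => by
  simpa [Function.comp_def] using (hw (t + s) (add_nonneg ht hs)).scomp t
    (((hasDerivAt_id t).add_const s).hasDerivWithinAt (s := Set.Ici 0))
    fun r hr => add_nonneg hr hs

lemma eq_exp [CompleteSpace E] (hw : IsTrajectory S w) {t : ℝ} (ht : 0 ≤ t) :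
    w t = NormedSpace.exp (t • S) (w 0) := by
  have hexp := isTrajectory_exp S (w 0)
  exact ODE_solution_unique (v := fun _ => S) (a := 0) (b := t) (fun _ => S.lipschitz)
    (hw.continuousOn.mono Set.Icc_subset_Ici_self)
    (fun s hs => (hw s hs.1).mono (Set.Ici_subset_Ici.2 hs.1))
    (hexp.continuousOn.mono Set.Icc_subset_Ici_self)
    (fun s hs => (hexp s hs.1).mono (Set.Ici_subset_Ici.2 hs.1)) (by simp) ⟨ht, le_rfl⟩

end IsTrajectory

/-- The unobservable subspace of the pair `(O, S)`: the largest `S`-invariant subspace of `ker O`,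
in which the states with identically zero output lie. -/
def unobservableSubspace (O : E →L[ℝ] F) (S : E →L[ℝ] E) : Submodule ℝ E :=
  ⨅ k : ℕ, (O ∘L S ^ k).ker

variable {O : E →L[ℝ] F}

lemma mem_unobservableSubspace {z : E} :
    z ∈ unobservableSubspace O S ↔ ∀ k : ℕ, O (S^[k] z) = 0 := by
  simp [unobservableSubspace, Module.End.pow_apply]

lemma apply_eq_zero_of_mem_unobservableSubspace {z : E} (hz : z ∈ unobservableSubspace O S) :
    O z = 0 := by
  simpa using mem_unobservableSubspace.1 hz 0

lemma apply_mem_unobservableSubspace {z : E} (hz : z ∈ unobservableSubspace O S) :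
    S z ∈ unobservableSubspace O S :=
  mem_unobservableSubspace.2 fun k =>
    mem_unobservableSubspace.1 hz (k + 1)

lemma IsTrajectory.mem_unobservableSubspace (hw : IsTrajectory S w)
    (hO : ∀ t, 0 ≤ t → O (w t) = 0) : w 0 ∈ unobservableSubspace O S := by
  have hpow (k : ℕ) : ∀ t, 0 ≤ t → O (S^[k] (w t)) = 0 := by
    induction k with
    | zero => simpa using hO
    | succ k ih =>
      intro t ht
      have hderiv : HasDerivWithinAt (fun t => O (S^[k] (w t))) (O (S^[k] (S (w t))))
          (Set.Ici 0) t := by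
        simpa [Function.comp_def] using (O ∘L S ^ k).hasFDerivAt.comp_hasDerivWithinAt t (hw t ht)
      have hzero := (hasDerivWithinAt_const t (Set.Ici 0) (0 : F)).congr ih (ih t ht)
      exact (uniqueDiffOn_Ici (0 : ℝ) t ht).eq_deriv _ hderiv hzero
  exact _root_.mem_unobservableSubspace.2 fun k => hpow k 0 le_rfl

end Trajectories

section Lyapunov

variable {E : Type*} [NormedAddCommGroup E] [NormedSpace ℝ E] {S : E →L[ℝ] E} {w : ℝ → E}

lemma exists_tendsto_atTop_of_antitoneOn_Ici {φ : ℝ → ℝ} (hφ : AntitoneOn φ (Set.Ici 0))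
    (hφ_nonneg : ∀ t, 0 ≤ φ t) : ∃ c, Filter.Tendsto φ Filter.atTop (nhds c) := by
  have hanti : Antitone fun t => φ (max t 0) := fun s t hst =>
    hφ (le_max_right s 0) (le_max_right t 0) (max_le_max_right 0 hst)
  refine ⟨_, (tendsto_atTop_ciInf hanti ⟨0, ?_⟩).congr' ?_⟩
  · rintro _ ⟨t, rfl⟩
    exact hφ_nonneg _
  · filter_upwards [Filter.eventually_ge_atTop 0] with t ht
    rw [max_eq_left ht]

lemma IsTrajectory.apply_exp_eq_of_tendsto [CompleteSpace E] (hw : IsTrajectory S w)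
    {V : E → ℝ} (hV : Continuous V) {c : ℝ}
    (hc : Filter.Tendsto (fun t => V (w t)) Filter.atTop (nhds c)) {U : Filter ℝ} [U.NeBot]
    (hU : U ≤ Filter.atTop) {z : E} (hz : Filter.Tendsto w U (nhds z)) {τ : ℝ} (hτ : 0 ≤ τ) :
    V (NormedSpace.exp (τ • S) z) = c := by
  have hflow : Filter.Tendsto (fun t => V (NormedSpace.exp (τ • S) (w t))) U
      (nhds (V (NormedSpace.exp (τ • S) z))) :=
    ((hV.comp (NormedSpace.exp (τ • S)).continuous).tendsto z).comp hz
  have hshift : Filter.Tendsto (fun t => V (w (τ + t))) U (nhds c) :=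
    (hc.comp (Filter.tendsto_atTop_add_const_left _ τ Filter.tendsto_id)).mono_left hU
  refine tendsto_nhds_unique (hflow.congr' (hU ?_)) hshift
  filter_upwards [Filter.eventually_ge_atTop 0] with t ht
  rw [(hw.comp_add_const ht).eq_exp hτ, zero_add]

lemma IsTrajectory.tendsto_apply_of_lyapunov [ProperSpace E]
    {V : E → ℝ} (hV : Continuous V) (hV_nonneg : ∀ z, 0 ≤ V z)
    (hV_bdd : ∀ c, Bornology.IsBounded {z | V z ≤ c})
    (hV_anti : ∀ w, IsTrajectory S w → AntitoneOn (fun t => V (w t)) (Set.Ici 0))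
    {X : Type*} [TopologicalSpace X] {g : E → X} (hg : Continuous g) {x : X}
    (hinv : ∀ w, IsTrajectory S w → (∀ t, 0 ≤ t → V (w t) = V (w 0)) → g (w 0) = x)
    (hw : IsTrajectory S w) : Filter.Tendsto (fun t => g (w t)) Filter.atTop (nhds x) := by
  obtain ⟨c, hc⟩ := exists_tendsto_atTop_of_antitoneOn_Ici (hV_anti w hw) fun t => hV_nonneg _
  -- LaSalle: `V` is constant along the trajectory through any limit point of `w`.
  rw [Filter.tendsto_iff_ultrafilter]
  intro U hU
  have hcompact : IsCompact {z | V z ≤ V (w 0)} :=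
    Metric.isCompact_of_isClosed_isBounded (isClosed_le hV continuous_const) (hV_bdd _)
  have hmem : ∀ᶠ t in U, w t ∈ {z | V z ≤ V (w 0)} := hU <| by
    filter_upwards [Filter.eventually_ge_atTop 0] with t ht
    exact hV_anti w hw Set.self_mem_Ici ht ht
  obtain ⟨z, -, hz⟩ := hcompact.ultrafilter_le_nhds (U.map w) (Filter.le_principal_iff.2 hmem)
  have hconst (τ : ℝ) (hτ : 0 ≤ τ) : V (NormedSpace.exp (τ • S) z) = c :=
    hw.apply_exp_eq_of_tendsto hV hc hU hz hτ
  have hgz : g z = x := by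
    simpa using hinv _ (isTrajectory_exp S z) fun t ht => by rw [hconst t ht, hconst 0 le_rfl]
  exact hgz ▸ (hg.tendsto z).comp hz

lemma exists_pos_mul_norm_sq_le [ProperSpace E] {V : E → ℝ} (hV : Continuous V)
    (hV_pos : ∀ z, z ≠ 0 → 0 < V z) (hV_smul : ∀ (a : ℝ) z, V (a • z) = a ^ 2 * V z) :
    ∃ c > 0, ∀ z, c * ‖z‖ ^ 2 ≤ V z := by
  have hV_zero : V 0 = 0 := by simpa using hV_smul 0 0
  rcases subsingleton_or_nontrivial E with hE | hE
  · exact ⟨1, one_pos, fun z => by simp [Subsingleton.elim z 0, hV_zero]⟩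
  obtain ⟨s, hs, hmin⟩ := (isCompact_sphere (0 : E) 1).exists_isMinOn
    (NormedSpace.sphere_nonempty.2 zero_le_one) hV.continuousOn
  refine ⟨V s, hV_pos s (by rintro rfl; simp at hs), fun z => ?_⟩
  rcases eq_or_ne z 0 with rfl | hz
  · simp [hV_zero]
  have hz_norm := norm_ne_zero_iff.2 hz
  have hle : V s ≤ V (‖z‖⁻¹ • z) := hmin (by simp [norm_smul, hz_norm])
  calc V s * ‖z‖ ^ 2 ≤ V (‖z‖⁻¹ • z) * ‖z‖ ^ 2 := by gcongr
    _ = V z := by rw [hV_smul]; field_simp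

lemma isBounded_setOf_le_of_quadratic [ProperSpace E] {V : E → ℝ} (hV : Continuous V)
    (hV_pos : ∀ z, z ≠ 0 → 0 < V z) (hV_smul : ∀ (a : ℝ) z, V (a • z) = a ^ 2 * V z) (r : ℝ) :
    Bornology.IsBounded {z | V z ≤ r} := by
  obtain ⟨c, hc, hle⟩ := exists_pos_mul_norm_sq_le hV hV_pos hV_smul
  refine (Metric.isBounded_closedBall (x := (0 : E)) (r := √(r / c))).subset fun z hz => ?_
  rw [mem_closedBall_zero_iff]
  exact Real.le_sqrt_of_sq_le ((le_div_iff₀' hc).2 ((hle z).trans hz))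

end Lyapunov

section DampedOscillator

variable {E F : Type*} [NormedAddCommGroup E] [NormedSpace ℝ E] [NormedAddCommGroup F]
  [NormedSpace ℝ F]

/-- The second order system `x'' + G x' + A x = 0` is a damped oscillator with respect to the mass
form `m`: the kinetic energy `m v v` and the potential energy `m (A x) x` are positive definite
quadratic forms, and the dissipation `m (G v) v` is a positive semidefinite one. -/
structure IsDampedOscillator (m : LinearMap.BilinForm ℝ E) (A G : E →L[ℝ] E) : Prop where
  mass_isSymm : m.IsSymm
  mass_pos : ∀ x, x ≠ 0 → 0 < m x x
  stiffness_isSymm : (m ∘ₗ A.toLinearMap).IsSymm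
  stiffness_pos : ∀ x, x ≠ 0 → 0 < m (A x) x
  damping_isPosSemidef : (m ∘ₗ G.toLinearMap).IsPosSemidef

/-- The vector field on pairs (position, velocity) of the second order system
`x'' + G x' + A x = 0`. -/
def dampedField (A G : E →L[ℝ] E) : E × E →L[ℝ] E × E :=
  (ContinuousLinearMap.snd ℝ E E).prod
    (-(G ∘L ContinuousLinearMap.snd ℝ E E + A ∘L ContinuousLinearMap.fst ℝ E E))

/-- The sum of the kinetic and the potential energy, up to the factor `1 / 2`. -/
def energy (m : LinearMap.BilinForm ℝ E) (A : E →L[ℝ] E) (z : E × E) : ℝ :=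
  m z.2 z.2 + m (A z.1) z.1

variable {m : LinearMap.BilinForm ℝ E} {A G : E →L[ℝ] E}

lemma dampedField_apply (z : E × E) : dampedField A G z = (z.2, -(G z.2 + A z.1)) :=
  rfl

lemma energy_smul (a : ℝ) (z : E × E) : energy m A (a • z) = a ^ 2 * energy m A z := by
  simp only [energy, Prod.smul_fst, Prod.smul_snd, map_smul, LinearMap.smul_apply, smul_eq_mul]
  ring

lemma continuous_energy [FiniteDimensional ℝ E] : Continuous (energy m A) := by
  have hm := m.toContinuousBilinearMap.continuous₂
  exact (hm.comp (continuous_snd.prodMk continuous_snd)).add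
    (hm.comp ((A.continuous.comp continuous_fst).prodMk continuous_fst))

namespace IsDampedOscillator

lemma energy_pos (h : IsDampedOscillator m A G) {z : E × E} (hz : z ≠ 0) :
    0 < energy m A z := by
  obtain ⟨x, v⟩ := z
  have hkinetic (hv : v ≠ 0) : 0 < m v v := h.mass_pos v hv
  have hpotential (hx : x ≠ 0) : 0 < m (A x) x := h.stiffness_pos x hx
  rcases eq_or_ne v 0 with rfl | hv
  · have hx : x ≠ 0 := by rintro rfl; exact hz rfl
    simpa [energy] using hpotential hx
  rcases eq_or_ne x 0 with rfl | hx
  · simpa [energy] using hkinetic hv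
  · exact add_pos (hkinetic hv) (hpotential hx)

lemma apply_eq_zero_of_dissipation_eq_zero (h : IsDampedOscillator m A G) {v : E}
    (hv : m (G v) v = 0) : G v = 0 := by
  have hker := (LinearMap.BilinForm.apply_apply_same_eq_zero_iff _
    h.damping_isPosSemidef.isNonneg.nonneg h.damping_isPosSemidef.isSymm).1 hv
  by_contra hGv
  exact (h.mass_pos _ hGv).ne' (LinearMap.congr_fun (LinearMap.mem_ker.1 hker) (G v))

variable [FiniteDimensional ℝ E]

lemma hasDerivWithinAt_energy (h : IsDampedOscillator m A G) {w : ℝ → E × E}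
    (hw : IsTrajectory (dampedField A G) w) {t : ℝ} (ht : 0 ≤ t) :
    HasDerivWithinAt (fun t => energy m A (w t)) (-2 * m (G (w t).2) (w t).2) (Set.Ici 0) t := by
  have hx : HasDerivWithinAt (fun t => (w t).1) (w t).2 (Set.Ici 0) t := (hw t ht).fst
  have hv : HasDerivWithinAt (fun t => (w t).2) (-(G (w t).2 + A (w t).1)) (Set.Ici 0) t :=
    (hw t ht).snd
  have hAx : HasDerivWithinAt (fun t => A (w t).1) (A (w t).2) (Set.Ici 0) t :=
    A.hasFDerivAt.comp_hasDerivWithinAt t hx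
  have hE := (m.toContinuousBilinearMap.hasDerivWithinAt_of_bilinear hv hv).add
    (m.toContinuousBilinearMap.hasDerivWithinAt_of_bilinear hAx hx)
  refine hE.congr_deriv ?_
  have hmass (x y : E) : m x y = m y x := h.mass_isSymm.eq x y
  have hstiff : m (A (w t).2) (w t).1 = m (A (w t).1) (w t).2 := h.stiffness_isSymm.eq _ _
  simp only [LinearMap.toContinuousBilinearMap_apply, hmass (w t).2, hstiff]
  simp only [map_neg, map_add, LinearMap.neg_apply, LinearMap.add_apply]
  ring

lemma antitoneOn_energy (h : IsDampedOscillator m A G) {w : ℝ → E × E}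
    (hw : IsTrajectory (dampedField A G) w) :
    AntitoneOn (fun t => energy m A (w t)) (Set.Ici 0) := by
  refine antitoneOn_of_hasDerivWithinAt_nonpos (convex_Ici 0)
    (fun t ht => (h.hasDerivWithinAt_energy hw ht).continuousWithinAt)
    (fun t ht => (h.hasDerivWithinAt_energy hw (interior_subset ht)).mono interior_subset)
    fun t _ => ?_
  have hdissipation : 0 ≤ m (G (w t).2) (w t).2 := h.damping_isPosSemidef.isNonneg.nonneg _
  linarith

lemma apply_velocity_eq_zero_of_energy_eq (h : IsDampedOscillator m A G) {w : ℝ → E × E}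
    (hw : IsTrajectory (dampedField A G) w)
    (hconst : ∀ t, 0 ≤ t → energy m A (w t) = energy m A (w 0)) {t : ℝ} (ht : 0 ≤ t) :
    G (w t).2 = 0 := by
  have hzero := (hasDerivWithinAt_const t (Set.Ici 0) (energy m A (w 0))).congr hconst
    (hconst t ht)
  have hderiv := (uniqueDiffOn_Ici (0 : ℝ) t ht).eq_deriv _ (h.hasDerivWithinAt_energy hw ht) hzero
  exact h.apply_eq_zero_of_dissipation_eq_zero (by linarith)

lemma fst_mem_of_mem_unobservableSubspace (h : IsDampedOscillator m A G) {N : Submodule ℝ E}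
    (hN : ∀ (μ : ℝ) u, A u = μ • u → G u = 0 → u ∈ N) {z : E × E}
    (hz : z ∈ unobservableSubspace (G ∘L ContinuousLinearMap.snd ℝ E E) (dampedField A G)) :
    z.1 ∈ N := by
  set U := unobservableSubspace (G ∘L ContinuousLinearMap.snd ℝ E E) (dampedField A G)
  have hG {z : E × E} (hz : z ∈ U) : G z.2 = 0 :=
    apply_eq_zero_of_mem_unobservableSubspace (O := G ∘L ContinuousLinearMap.snd ℝ E E) hz
  have hfield {z : E × E} (hz : z ∈ U) : (z.2, -A z.1) ∈ U := by
    simpa [dampedField_apply, hG hz] using apply_mem_unobservableSubspace hz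
  -- The velocities of states in `U` form a subspace of `ker G` that `A` maps bijectively to itself,
  -- and `A` maps the positions of such states into it.
  let p : Submodule ℝ E := U.map (LinearMap.snd ℝ E E)
  have hp_inv : ∀ v ∈ p, A v ∈ p := by
    rintro _ ⟨z, hz, rfl⟩
    exact ⟨_, U.neg_mem (hfield (hfield hz)), by simp⟩
  have hp_le : p ≤ N := by
    refine le_of_forall_eigenvector_mem (iSup_eigenspace_eq_top_of_isSymm h.mass_isSymm h.mass_pos
      h.stiffness_isSymm) hp_inv fun μ u hu hup => hN μ u hu ?_
    obtain ⟨z, hz, rfl⟩ := hup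
    exact hG hz
  have hA_inj : Function.Injective A := (injective_iff_map_eq_zero A).2 fun x hx => by
    by_contra hne
    simpa [hx] using h.stiffness_pos x hne
  have hp_map : p.map A.toLinearMap = p :=
    Submodule.eq_of_le_of_finrank_eq (Submodule.map_le_iff_le_comap.2 hp_inv)
      (Submodule.equivMapOfInjective A.toLinearMap hA_inj p).finrank_eq.symm
  have hAz : A z.1 ∈ p.map A.toLinearMap :=
    hp_map.symm ▸ ⟨_, U.neg_mem (hfield hz), by simp⟩
  exact hp_le (hA_inj.mem_set_image.1 hAz)

theorem tendsto_apply_position_zero (h : IsDampedOscillator m A G) {P : E →L[ℝ] F}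
    (hP : ∀ (μ : ℝ) u, A u = μ • u → G u = 0 → P u = 0) {w : ℝ → E × E}
    (hw : IsTrajectory (dampedField A G) w) :
    Filter.Tendsto (fun t => P (w t).1) Filter.atTop (nhds 0) := by
  have : ProperSpace (E × E) := FiniteDimensional.proper ℝ _
  have hpos (z : E × E) (hz : z ≠ 0) : 0 < energy m A z := h.energy_pos hz
  refine hw.tendsto_apply_of_lyapunov (V := energy m A) (g := fun z => P z.1) continuous_energy
    (fun z => ?_) (isBounded_setOf_le_of_quadratic continuous_energy hpos energy_smul)
    (fun w hw => h.antitoneOn_energy hw) (P.continuous.comp continuous_fst)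
    fun w hw hconst => ?_
  · rcases eq_or_ne z 0 with rfl | hz
    · simp [energy]
    · exact (hpos z hz).le
  · exact h.fst_mem_of_mem_unobservableSubspace (N := P.ker) hP <|
      hw.mem_unobservableSubspace fun t ht => h.apply_velocity_eq_zero_of_energy_eq hw hconst ht

end IsDampedOscillator

end DampedOscillator

section Pencil

lemma mulVec_dotProduct_of_isSymm {κ R : Type*} [Fintype κ] [CommSemiring R] {W : Matrix κ κ R}
    (hW : W.IsSymm) (x y : κ → R) : (W *ᵥ x) ⬝ᵥ y = x ⬝ᵥ W *ᵥ y := by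
  rw [Matrix.dotProduct_mulVec, ← Matrix.mulVec_transpose, hW.eq]

lemma pos_of_mulVec_eq_smul_mulVec {κ : Type*} [Fintype κ] {M K : Matrix κ κ ℝ}
    (hM : M.PosDef) (hK : K.PosDef) {μ : ℝ} {u : κ → ℝ} (hu_ne : u ≠ 0)
    (hu : K *ᵥ u = μ • M *ᵥ u) : 0 < μ := by
  have hKu := hK.dotProduct_mulVec_pos hu_ne
  rw [hu, dotProduct_smul, smul_eq_mul] at hKu
  exact pos_of_mul_pos_left hKu (hM.dotProduct_mulVec_pos hu_ne).le

variable {κ : Type*} [Fintype κ] [DecidableEq κ]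

lemma inv_mulVec_dotProduct_mulVec {R : Type*} [CommRing R] {M : Matrix κ κ R} (hM : M.IsSymm)
    (hdet : IsUnit M.det) (x y : κ → R) : (M⁻¹ *ᵥ x) ⬝ᵥ M *ᵥ y = x ⬝ᵥ y := by
  rw [← mulVec_dotProduct_of_isSymm hM, Matrix.mulVec_mulVec, Matrix.mul_nonsing_inv M hdet,
    Matrix.one_mulVec]

lemma inv_mulVec_eq_iff {R : Type*} [CommRing R] {M : Matrix κ κ R} (hdet : IsUnit M.det)
    {x y : κ → R} : M⁻¹ *ᵥ x = y ↔ x = M *ᵥ y := by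
  constructor
  · rintro rfl
    rw [Matrix.mulVec_mulVec, Matrix.mul_nonsing_inv M hdet, Matrix.one_mulVec]
  · rintro rfl
    rw [Matrix.mulVec_mulVec, Matrix.nonsing_inv_mul M hdet, Matrix.one_mulVec]

variable {M K : Matrix κ κ ℝ}

lemma iSup_eigenspace_inv_mul_eq_top (hM : M.PosDef) (hK : K.IsSymm) :
    ⨆ μ, Module.End.eigenspace (M⁻¹ * K).mulVecLin μ = ⊤ := by
  have hM_symm := Matrix.isHermitian_iff_isSymm.1 hM.isHermitian
  refine iSup_eigenspace_eq_top_of_isSymm (m := Matrix.toBilin' M)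
    (Matrix.isSymm_toBilin'_iff_isSymm.2 hM_symm) (fun x hx => ?_) ⟨fun x y => ?_⟩
  · simpa [Matrix.toBilin'_apply'] using hM.dotProduct_mulVec_pos hx
  · simp only [LinearMap.comp_apply, Matrix.mulVecLin_apply, ← Matrix.mulVec_mulVec,
      Matrix.toBilin'_apply', inv_mulVec_dotProduct_mulVec hM_symm hM.det_pos.ne'.isUnit,
      mulVec_dotProduct_of_isSymm hK, RingHom.id_apply]
    exact (dotProduct_comm _ _).trans (mulVec_dotProduct_of_isSymm hK _ _)

lemma inv_mul_mulVec_eq_smul_iff (hM : M.PosDef) {μ : ℝ} {u : κ → ℝ} :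
    (M⁻¹ * K) *ᵥ u = μ • u ↔ K *ᵥ u = μ • M *ᵥ u := by
  rw [← Matrix.mulVec_mulVec, inv_mulVec_eq_iff hM.det_pos.ne'.isUnit, Matrix.mulVec_smul]

lemma exists_mulVec_eq_smul_mulVec {κ : Type*} [Fintype κ] [Nonempty κ] {M K : Matrix κ κ ℝ}
    (hM : M.PosDef) (hK : K.IsSymm) : ∃ (μ : ℝ) (u : κ → ℝ), u ≠ 0 ∧ K *ᵥ u = μ • M *ᵥ u := by
  classical
  by_contra! h
  have htop : (⊤ : Submodule ℝ (κ → ℝ)) ≤ ⊥ :=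
    le_of_forall_eigenvector_mem (iSup_eigenspace_inv_mul_eq_top hM hK)
      (fun _ _ => Submodule.mem_top) fun μ u hu _ => by
        by_contra hne
        exact h μ u hne ((inv_mul_mulVec_eq_smul_iff hM).1 hu)
  exact top_ne_bot (le_bot_iff.1 htop)

end Pencil

section Observability

variable {m n : ℕ} {C : Matrix (Fin m) (Fin n) ℝ}

lemma isObservable_iff_forall_eigenvector {A : Matrix (Fin n) (Fin n) ℝ}
    (hA : ⨆ μ, Module.End.eigenspace A.mulVecLin μ = ⊤) :
    IsObservable C A ↔ ∀ (μ : ℝ) u, A *ᵥ u = μ • u → C *ᵥ u = 0 → u = 0 := by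
  let S := A.mulVecLin.toContinuousLinearMap
  let O := C.mulVecLin.toContinuousLinearMap
  constructor
  · intro hobs μ u hu hCu
    have hexp : IsTrajectory S fun t => Real.exp (μ * t) • u := isTrajectory_exp_smul hu
    have hzero : IsTrajectory S fun _ => 0 := fun t _ => by
      simpa using hasDerivWithinAt_const t (Set.Ici 0) (0 : Fin n → ℝ)
    simpa using hobs _ _ hexp hzero fun t _ => by simp [Matrix.mulVec_smul, hCu]
  · intro hker x₁ x₂ hx₁ hx₂ hout
    have hdiff : IsTrajectory S fun t => x₁ t - x₂ t := IsTrajectory.sub hx₁ hx₂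
    have hmem : x₁ 0 - x₂ 0 ∈ unobservableSubspace O S := hdiff.mem_unobservableSubspace
      fun t ht => by simp [O, Matrix.mulVec_sub, hout t ht]
    have hbot : unobservableSubspace O S ≤ ⊥ :=
      le_of_forall_eigenvector_mem hA (fun _ => apply_mem_unobservableSubspace)
        fun μ u hu humem => hker μ u hu (apply_eq_zero_of_mem_unobservableSubspace humem)
    exact sub_eq_zero.1 (hbot hmem)

lemma isObservable_inv_mul_iff {M K : Matrix (Fin n) (Fin n) ℝ} (hM : M.PosDef) (hK : K.IsSymm) :
    IsObservable C (M⁻¹ * K) ↔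
      ∀ (μ : ℝ) u, K *ᵥ u = μ • M *ᵥ u → C *ᵥ u = 0 → u = 0 := by
  simp only [isObservable_iff_forall_eigenvector (iSup_eigenspace_inv_mul_eq_top hM hK),
    inv_mul_mulVec_eq_smul_iff hM]

end Observability

section Array

variable {ι κ : Type*} [Fintype ι] [Fintype κ]

/-- The generalized force `∑ⱼ Dᵢⱼ (vᵢ - vⱼ)` that dissipative coupling exerts against the velocities
`v` of an array. -/
def coupling (D : ι → ι → Matrix κ κ ℝ) : (ι → κ → ℝ) →ₗ[ℝ] ι → κ → ℝ :=
  LinearMap.pi fun i => ∑ j, (D i j).mulVecLin ∘ₗ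
    (LinearMap.proj (R := ℝ) (φ := fun _ => κ → ℝ) i - LinearMap.proj j)

variable {D : ι → ι → Matrix κ κ ℝ}

lemma coupling_apply (v : ι → κ → ℝ) (i : ι) :
    coupling D v i = ∑ j, D i j *ᵥ (v i - v j) := by
  simp [coupling]

lemma two_nsmul_sum_dotProduct_coupling (hD_comm : ∀ i j, D i j = D j i) (y v : ι → κ → ℝ) :
    2 • ∑ i, y i ⬝ᵥ coupling D v i = ∑ i, ∑ j, (y i - y j) ⬝ᵥ D i j *ᵥ (v i - v j) := by
  simpa only [coupling_apply, dotProductBilin_apply_apply] using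
    two_nsmul_sum_apply_sum_of_antisymm (dotProductBilin ℝ ℝ) y
      (f := fun i j => D i j *ᵥ (v i - v j)) fun i j => by
        rw [hD_comm j i, ← Matrix.mulVec_neg, neg_sub]

lemma sum_dotProduct_coupling_comm (hD : ∀ i j, (D i j).IsSymm)
    (hD_comm : ∀ i j, D i j = D j i) (y v : ι → κ → ℝ) :
    ∑ i, y i ⬝ᵥ coupling D v i = ∑ i, v i ⬝ᵥ coupling D y i := by
  have hdouble : 2 • ∑ i, y i ⬝ᵥ coupling D v i = 2 • ∑ i, v i ⬝ᵥ coupling D y i := by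
    simp only [two_nsmul_sum_dotProduct_coupling hD_comm]
    refine Finset.sum_congr rfl fun i _ => Finset.sum_congr rfl fun j _ => ?_
    rw [dotProduct_comm, mulVec_dotProduct_of_isSymm (hD i j)]
  simpa using hdouble

lemma sum_dotProduct_coupling_self_nonneg (hD : ∀ i j, (D i j).PosSemidef)
    (hD_comm : ∀ i j, D i j = D j i) (v : ι → κ → ℝ) : 0 ≤ ∑ i, v i ⬝ᵥ coupling D v i := by
  have hdouble : 0 ≤ 2 • ∑ i, v i ⬝ᵥ coupling D v i := by
    rw [two_nsmul_sum_dotProduct_coupling hD_comm]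
    exact Finset.sum_nonneg fun i _ => Finset.sum_nonneg fun j _ => by
      simpa using (hD i j).dotProduct_mulVec_nonneg (v i - v j)
  simpa using hdouble

lemma coupling_eq_zero_iff (hD : ∀ i j, (D i j).PosSemidef) (hD_comm : ∀ i j, D i j = D j i)
    {v : ι → κ → ℝ} : coupling D v = 0 ↔ ∀ i j, D i j *ᵥ (v i - v j) = 0 := by
  refine ⟨fun hv i j => ?_, fun hv => funext fun i => ?_⟩
  · have hsum := two_nsmul_sum_dotProduct_coupling hD_comm v v
    simp only [hv, Pi.zero_apply, dotProduct_zero, Finset.sum_const_zero, smul_zero] at hsum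
    have hterm (i j : ι) : 0 ≤ (v i - v j) ⬝ᵥ D i j *ᵥ (v i - v j) := by
      simpa using (hD i j).dotProduct_mulVec_nonneg (v i - v j)
    have hij := (sum_sum_eq_zero_iff_of_nonneg hterm).1 hsum.symm i j
    exact ((hD i j).dotProduct_mulVec_zero_iff _).1 (by simpa using hij)
  · rw [coupling_apply]
    exact Finset.sum_eq_zero fun j _ => hv i j

lemma sum_dotProduct_mulVec_self_pos {W : Matrix κ κ ℝ} (hW : W.PosDef) {x : ι → κ → ℝ}
    (hx : x ≠ 0) : 0 < ∑ i, x i ⬝ᵥ W *ᵥ x i := by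
  obtain ⟨i, hi⟩ := Function.ne_iff.1 hx
  refine Finset.sum_pos' (fun j _ => ?_) ⟨i, Finset.mem_univ i, ?_⟩
  · simpa using hW.posSemidef.dotProduct_mulVec_nonneg (x j)
  · simpa using hW.dotProduct_mulVec_pos hi

variable [DecidableEq κ] {M K : Matrix κ κ ℝ}

/-- The mass form `∑ᵢ xᵢᵀ M yᵢ` of an array of `ι` oscillators with the common mass matrix `M`. -/
noncomputable def massForm (ι : Type*) [Fintype ι] (M : Matrix κ κ ℝ) :
    LinearMap.BilinForm ℝ (ι → κ → ℝ) :=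
  ∑ i, (Matrix.toBilin' M).comp (LinearMap.proj i) (LinearMap.proj i)

/-- The stiffness operator `xᵢ ↦ M⁻¹ K xᵢ` of an array, relative to its mass matrix. -/
noncomputable def arrayStiffness (ι : Type*) [Fintype ι] (M K : Matrix κ κ ℝ) :
    (ι → κ → ℝ) →L[ℝ] ι → κ → ℝ :=
  ((M⁻¹ * K).mulVecLin.compLeft ι).toContinuousLinearMap

/-- The damping operator `vᵢ ↦ M⁻¹ ∑ⱼ Dᵢⱼ (vᵢ - vⱼ)` of an array, relative to its mass matrix. -/
noncomputable def arrayDamping (M : Matrix κ κ ℝ) (D : ι → ι → Matrix κ κ ℝ) :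
    (ι → κ → ℝ) →L[ℝ] ι → κ → ℝ :=
  (M⁻¹.mulVecLin.compLeft ι ∘ₗ coupling D).toContinuousLinearMap

lemma massForm_apply (x y : ι → κ → ℝ) : massForm ι M x y = ∑ i, x i ⬝ᵥ M *ᵥ y i := by
  simp [massForm, Matrix.toBilin'_apply']

lemma arrayStiffness_apply (x : ι → κ → ℝ) (i : ι) :
    arrayStiffness ι M K x i = (M⁻¹ * K) *ᵥ x i :=
  rfl

lemma arrayDamping_apply (v : ι → κ → ℝ) (i : ι) :
    arrayDamping M D v i = M⁻¹ *ᵥ coupling D v i :=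
  rfl

lemma massForm_arrayStiffness_apply (hM : M.PosDef) (x y : ι → κ → ℝ) :
    massForm ι M (arrayStiffness ι M K x) y = ∑ i, (K *ᵥ x i) ⬝ᵥ y i := by
  simp only [massForm_apply, arrayStiffness_apply, ← Matrix.mulVec_mulVec,
    inv_mulVec_dotProduct_mulVec (Matrix.isHermitian_iff_isSymm.1 hM.isHermitian)
      hM.det_pos.ne'.isUnit]

lemma massForm_arrayDamping_apply (hM : M.PosDef) (x y : ι → κ → ℝ) :
    massForm ι M (arrayDamping M D x) y = ∑ i, coupling D x i ⬝ᵥ y i := by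
  simp only [massForm_apply, arrayDamping_apply,
    inv_mulVec_dotProduct_mulVec (Matrix.isHermitian_iff_isSymm.1 hM.isHermitian)
      hM.det_pos.ne'.isUnit]

lemma isDampedOscillator_array (hM : M.PosDef) (hK : K.PosDef) (hD : ∀ i j, (D i j).PosSemidef)
    (hD_comm : ∀ i j, D i j = D j i) :
    IsDampedOscillator (massForm ι M) (arrayStiffness ι M K) (arrayDamping M D) where
  mass_isSymm := ⟨fun x y => by
    have hM_symm := Matrix.isHermitian_iff_isSymm.1 hM.isHermitian
    simp only [massForm_apply]
    exact Finset.sum_congr rfl fun i _ =>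
      (mulVec_dotProduct_of_isSymm hM_symm _ _).symm.trans (dotProduct_comm _ _)⟩
  mass_pos x hx := by
    rw [massForm_apply]
    exact sum_dotProduct_mulVec_self_pos hM hx
  stiffness_isSymm := ⟨fun x y => by
    have hK_symm := Matrix.isHermitian_iff_isSymm.1 hK.isHermitian
    simp only [LinearMap.comp_apply, ContinuousLinearMap.coe_coe, RingHom.id_apply,
      massForm_arrayStiffness_apply hM]
    exact Finset.sum_congr rfl fun i _ =>
      (mulVec_dotProduct_of_isSymm hK_symm _ _).trans (dotProduct_comm _ _)⟩
  stiffness_pos x hx := by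
    simp only [massForm_arrayStiffness_apply hM, dotProduct_comm (K *ᵥ _)]
    exact sum_dotProduct_mulVec_self_pos hK hx
  damping_isPosSemidef :=
    { eq := fun x y => by
        simpa [massForm_arrayDamping_apply hM, dotProduct_comm (coupling D _ _)] using
          sum_dotProduct_coupling_comm
            (fun i j => Matrix.isHermitian_iff_isSymm.1 (hD i j).isHermitian) hD_comm y x
      nonneg := fun x => by
        simpa [massForm_arrayDamping_apply hM, dotProduct_comm (coupling D _ _)] using
          sum_dotProduct_coupling_self_nonneg hD hD_comm x }

end Array

section Modes

/-- `u` is an undamped mode, with squared frequency `μ`, of the array with coupling `D`: every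
oscillator moves along a solution of the pencil equation `K u = μ M u` (or rests), and no coupling
dissipates energy. -/
def IsUndampedMode {ι κ : Type*} [Fintype κ] (M K : Matrix κ κ ℝ) (D : ι → ι → Matrix κ κ ℝ)
    (μ : ℝ) (u : ι → κ → ℝ) : Prop :=
  (∀ i, K *ᵥ u i = μ • M *ᵥ u i) ∧ ∀ i j, D i j *ᵥ (u i - u j) = 0

lemma IsUndampedMode.mulVec_sub {ι κ : Type*} [Fintype κ] {M K : Matrix κ κ ℝ}
    {D : ι → ι → Matrix κ κ ℝ} {μ : ℝ} {u : ι → κ → ℝ} (hu : IsUndampedMode M K D μ u) (i j : ι) :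
    K *ᵥ (u i - u j) = μ • M *ᵥ (u i - u j) := by
  rw [Matrix.mulVec_sub, Matrix.mulVec_sub, hu.1, hu.1, smul_sub]

lemma isUndampedMode_of_arrayStiffness_eq_smul {ι κ : Type*} [Fintype ι] [Fintype κ]
    [DecidableEq κ] {M K : Matrix κ κ ℝ} {D : ι → ι → Matrix κ κ ℝ} (hM : M.PosDef)
    (hD : ∀ i j, (D i j).PosSemidef) (hD_comm : ∀ i j, D i j = D j i) {μ : ℝ} {u : ι → κ → ℝ}
    (hu : arrayStiffness ι M K u = μ • u) (hdamp : arrayDamping M D u = 0) :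
    IsUndampedMode M K D μ u := by
  refine ⟨fun i => (inv_mul_mulVec_eq_smul_iff hM).1 (congrFun hu i),
    (coupling_eq_zero_iff hD hD_comm).1 (funext fun i => ?_)⟩
  have hi : M⁻¹ *ᵥ coupling D u i = 0 := congrFun hdamp i
  rw [(inv_mulVec_eq_iff hM.det_pos.ne'.isUnit).1 hi, Matrix.mulVec_zero, Pi.zero_apply]

variable {q n : ℕ} {M K : Matrix (Fin n) (Fin n) ℝ}
  {D : Fin q → Fin q → Matrix (Fin n) (Fin n) ℝ}

lemma IsArraySolution.exists_isTrajectory (hM : M.PosDef) {x : ℝ → Fin q → Fin n → ℝ}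
    (hx : IsArraySolution M K D x) :
    ∃ w, IsTrajectory (dampedField (arrayStiffness (Fin q) M K) (arrayDamping M D)) w ∧
      ∀ t, (w t).1 = x t := by
  obtain ⟨v, a, hsol⟩ := hx
  refine ⟨fun t => (x t, v t), fun t ht => ?_, fun _ => rfl⟩
  obtain ⟨hpos, hvel, hforce⟩ := hsol t ht
  have hacc : a t = -(arrayDamping M D (v t) + arrayStiffness (Fin q) M K (x t)) := by
    funext i
    have hi : M *ᵥ a t i = -(coupling D (v t) i + K *ᵥ x t i) := by
      rw [eq_neg_iff_add_eq_zero, coupling_apply, ← hforce i]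
      abel
    rw [← (inv_mulVec_eq_iff hM.det_pos.ne'.isUnit).2 hi.symm, Matrix.mulVec_neg,
      Matrix.mulVec_add, Matrix.mulVec_mulVec, Pi.neg_apply, Pi.add_apply, arrayDamping_apply,
      arrayStiffness_apply]
  rw [dampedField_apply, ← hacc]
  exact hpos.prodMk hvel

lemma IsUndampedMode.isArraySolution_cos {ω : ℝ} {u : Fin q → Fin n → ℝ}
    (hu : IsUndampedMode M K D (ω ^ 2) u) :
    IsArraySolution M K D fun t => Real.cos (ω * t) • u := by
  have hphase (t : ℝ) : HasDerivAt (fun t => ω * t) ω t := by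
    simpa using (hasDerivAt_id t).const_mul ω
  refine ⟨fun t => (-Real.sin (ω * t) * ω) • u, fun t => (-(Real.cos (ω * t) * ω) * ω) • u,
    fun t _ => ⟨?_, ?_, fun i => ?_⟩⟩
  · exact ((hphase t).cos.smul_const u).hasDerivWithinAt
  · exact (((hphase t).sin.fun_neg.mul_const ω).smul_const u).hasDerivWithinAt
  · simp only [Pi.smul_apply, ← smul_sub, Matrix.mulVec_smul, hu.1, hu.2, smul_zero,
      Finset.sum_const_zero, add_zero, smul_smul, ← add_smul]
    convert zero_smul ℝ _ using 2
    ring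

lemma Synchronizes.eq_of_isUndampedMode (hsync : Synchronizes M K D) {μ : ℝ} (hμ : 0 < μ)
    {u : Fin q → Fin n → ℝ} (hu : IsUndampedMode M K D μ u) (i j : Fin q) : u i = u j := by
  rw [← Real.sq_sqrt hμ.le] at hu
  have hperiods : Filter.Tendsto (fun k : ℕ => (k : ℝ) * (2 * Real.pi / √μ)) Filter.atTop
      Filter.atTop :=
    tendsto_natCast_atTop_atTop.atTop_mul_const (by positivity)
  have hlim := (hsync _ hu.isArraySolution_cos i j).comp hperiods
  have hphase (k : ℕ) : √μ * (k * (2 * Real.pi / √μ)) = k * (2 * Real.pi) := by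
    field_simp
  simp only [Function.comp_def, hphase, Real.cos_nat_mul_two_pi, one_smul] at hlim
  have hnorm := tendsto_nhds_unique tendsto_const_nhds hlim
  rwa [norm_eq_zero, WithLp.toLp_eq_zero, sub_eq_zero] at hnorm

theorem synchronizes_iff_forall_isUndampedMode (hM : M.PosDef) (hK : K.PosDef)
    (hD : ∀ i j, (D i j).PosSemidef) (hD_comm : ∀ i j, D i j = D j i) :
    Synchronizes M K D ↔ ∀ μ u, IsUndampedMode M K D μ u → ∀ i j, u i = u j := by
  constructor
  · intro hsync μ u hu i j
    by_contra hne
    have hμ := pos_of_mulVec_eq_smul_mulVec hM hK (sub_ne_zero.2 hne) (hu.mulVec_sub i j)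
    exact hne (hsync.eq_of_isUndampedMode hμ hu i j)
  · intro hmodes x hx i j
    obtain ⟨w, hw, hwx⟩ := hx.exists_isTrajectory hM
    let P : (Fin q → Fin n → ℝ) →L[ℝ] Fin n → ℝ :=
      ContinuousLinearMap.proj (R := ℝ) (φ := fun _ => Fin n → ℝ) i - ContinuousLinearMap.proj j
    have hlim : Filter.Tendsto (fun t => P (w t).1) Filter.atTop (nhds 0) :=
      (isDampedOscillator_array hM hK hD hD_comm).tendsto_apply_position_zero
        (fun μ u hu hdamp => sub_eq_zero.2 <| hmodes μ u
          (isUndampedMode_of_arrayStiffness_eq_smul hM hD hD_comm hu hdamp) i j) hw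
    have hnorm := ((PiLp.continuous_toLp 2 fun _ : Fin n => ℝ).norm.tendsto 0).comp hlim
    simpa [P, Function.comp_def, hwx] using hnorm

end Modes

section OutputCoupling

lemma smul_transpose_mul_self_mulVec_eq_zero_iff {m κ : Type*} [Fintype m] [Fintype κ]
    {C : Matrix m κ ℝ} {c : ℝ} {y : κ → ℝ} :
    (c • (Cᵀ * C)) *ᵥ y = 0 ↔ c • C *ᵥ y = 0 := by
  rw [Matrix.smul_mulVec, smul_eq_zero, smul_eq_zero,
    ← Matrix.conjTranspose_eq_transpose_of_trivial, Matrix.conjTranspose_mul_self_mulVec_eq_zero]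

variable {q n m : ℕ} {M K : Matrix (Fin n) (Fin n) ℝ} {C : Matrix (Fin m) (Fin n) ℝ}
  {d : Fin q → Fin q → ℝ}

lemma posSemidef_smul_transpose_mul_self {c : ℝ} (hc : 0 ≤ c) : (c • (Cᵀ * C)).PosSemidef := by
  simpa using (Matrix.posSemidef_conjTranspose_mul_self C).smul hc

lemma isUndampedMode_outputCoupling_iff (hd_nonneg : ∀ i j, 0 ≤ d i j)
    (hd_symm : ∀ i j, d i j = d j i) (hd_diag : ∀ i, d i i = 0) {μ : ℝ} {u : Fin q → Fin n → ℝ} :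
    IsUndampedMode M K (fun i j => d i j • (Cᵀ * C)) μ u ↔
      (∀ i, K *ᵥ u i = μ • M *ᵥ u i) ∧ ∀ k, lap d *ᵥ (fun i => (C *ᵥ u i) k) = 0 := by
  simp only [IsUndampedMode, smul_transpose_mul_self_mulVec_eq_zero_iff,
    lap_mulVec_eq_zero_iff hd_nonneg hd_symm hd_diag]
  refine and_congr_right fun _ => ⟨fun hout k i j => ?_, fun hout i j => funext fun k => ?_⟩
  · simpa [Matrix.mulVec_sub] using congrFun (hout i j) k
  · simpa [Matrix.mulVec_sub] using hout k i j

lemma isUndampedMode_outputCoupling_smul (hd_nonneg : ∀ i j, 0 ≤ d i j)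
    (hd_symm : ∀ i j, d i j = d j i) (hd_diag : ∀ i, d i i = 0) {μ : ℝ} {u : Fin n → ℝ}
    (hu : K *ᵥ u = μ • M *ᵥ u) {z : Fin q → ℝ} (hzero : lap d *ᵥ z = 0 ∨ C *ᵥ u = 0) :
    IsUndampedMode M K (fun i j => d i j • (Cᵀ * C)) μ fun i => z i • u := by
  refine (isUndampedMode_outputCoupling_iff hd_nonneg hd_symm hd_diag).2 ⟨fun i => ?_, fun k => ?_⟩
  · rw [Matrix.mulVec_smul, Matrix.mulVec_smul, hu, smul_comm]
  · have hout : (fun i => (C *ᵥ (z i • u)) k) = (C *ᵥ u) k • z := by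
      ext i
      simp [Matrix.mulVec_smul, mul_comm]
    rw [hout, Matrix.mulVec_smul]
    rcases hzero with hz | hCu
    · rw [hz, smul_zero]
    · rw [hCu, Pi.zero_apply, zero_smul]

theorem forall_isUndampedMode_outputCoupling_eq_iff (hq : 2 ≤ q) (hn : 1 ≤ n) (hM : M.PosDef)
    (hK : K.IsSymm) (hd_nonneg : ∀ i j, 0 ≤ d i j) (hd_symm : ∀ i j, d i j = d j i)
    (hd_diag : ∀ i, d i i = 0) :
    (∀ μ u, IsUndampedMode M K (fun i j => d i j • (Cᵀ * C)) μ u → ∀ i j, u i = u j) ↔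
      (∀ z, lap d *ᵥ z = 0 → ∀ i j, z i = z j) ∧
        ∀ (μ : ℝ) u, K *ᵥ u = μ • M *ᵥ u → C *ᵥ u = 0 → u = 0 := by
  constructor
  · refine fun hmodes => ⟨fun z hz i j => ?_, fun μ u hu hCu => ?_⟩
    · have : Nonempty (Fin n) := ⟨⟨0, hn⟩⟩
      obtain ⟨μ, u, hu_ne, hu⟩ := exists_mulVec_eq_smul_mulVec hM hK
      exact smul_left_injective ℝ hu_ne (hmodes μ _
        (isUndampedMode_outputCoupling_smul hd_nonneg hd_symm hd_diag hu (.inl hz)) i j)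
    · have hmode := isUndampedMode_outputCoupling_smul hd_nonneg hd_symm hd_diag hu
        (z := Pi.single ⟨0, by lia⟩ 1) (.inr hCu)
      simpa [Pi.single_apply, Fin.ext_iff] using hmodes μ _ hmode ⟨0, by lia⟩ ⟨1, by lia⟩
  · rintro ⟨hlap, hobs⟩ μ u hu i j
    have hker := ((isUndampedMode_outputCoupling_iff hd_nonneg hd_symm hd_diag).1 hu).2
    refine sub_eq_zero.1 (hobs μ (u i - u j) (hu.mulVec_sub i j) (funext fun k => ?_))
    rw [Matrix.mulVec_sub, Pi.sub_apply, hlap _ (hker k) i j, sub_self, Pi.zero_apply]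

end OutputCoupling

theorem mainTheorem5_general (q n m : ℕ) (hq : 2 ≤ q) (hn : 1 ≤ n)
    (M K : Matrix (Fin n) (Fin n) ℝ) (hM : M.PosDef) (hK : K.PosDef)
    (C : Matrix (Fin m) (Fin n) ℝ) (d : Fin q → Fin q → ℝ)
    (hd_nonneg : ∀ i j, 0 ≤ d i j) (hd_symm : ∀ i j, d i j = d j i) (hd_diag : ∀ i, d i i = 0) :
    Synchronizes M K (fun i j => d i j • (Cᵀ * C)) ↔
      0 < reEigenvalue ((lap d).map Complex.ofReal) 2 ∧ IsObservable C (M⁻¹ * K) := by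
  have hK_symm := Matrix.isHermitian_iff_isSymm.1 hK.isHermitian
  rw [synchronizes_iff_forall_isUndampedMode hM hK
      (fun i j => posSemidef_smul_transpose_mul_self (hd_nonneg i j))
      (fun i j => by rw [hd_symm i j]),
    forall_isUndampedMode_outputCoupling_eq_iff hq hn hM hK_symm hd_nonneg hd_symm hd_diag,
    zero_lt_reEigenvalue_lap_two_iff hq hd_nonneg hd_symm hd_diag,
    isObservable_inv_mul_iff hM hK_symm]

theorem mainTheorem5 (q n m : ℕ) (hq : 2 ≤ q) (hn : 1 ≤ n)
    (M K : Matrix (Fin n) (Fin n) ℝ) (hM : M.PosDef) (hK : K.PosDef)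
    (hσ : (pencilPoly M K).roots.Nodup)
    (C : Matrix (Fin m) (Fin n) ℝ) (d : Fin q → Fin q → ℝ)
    (hd_nonneg : ∀ i j, 0 ≤ d i j) (hd_symm : ∀ i j, d i j = d j i) (hd_diag : ∀ i, d i i = 0) :
    Synchronizes M K (fun i j => d i j • (Cᵀ * C)) ↔
      0 < reEigenvalue ((lap d).map Complex.ofReal) 2 ∧ IsObservable C (M⁻¹ * K) :=
  mainTheorem5_general q n m hq hn M K hM hK C d hd_nonneg hd_symm hd_diag
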